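/- For a finite group $G$ with subgroup $H$, let $W_1,\dots,W_r$ and $V_1,\dots,V_s$ be the simple modules, up to isomorphism, of the complex group algebras $\mathbb{C}H$ and $\mathbb{C}G$ respectively, and let $M=(m_{ij})$ be the inclusion matrix of $\mathbb{C}H\subseteq\mathbb{C}G$: the $r\times s$ matrix in which $m_{ij}$ is the multiplicity of $W_i$ in the restriction of $V_j$ to $\mathbb{C}H$. Put $S=MM^{t}$, and $M^{2k}=S^{k}$, $M^{2k+1}=S^{k}M$ for $k\ge 0$. The subgroup $H$ (equivalently, the ring extension $\mathbb{C}H\subseteq\mathbb{C}G$) is said to have depth $n$ if $n$ is the least integer $\ge 2$ such that $M^{n+1}\le q\,M^{n-1}$ holds entrywise for some positive integer $q$. Let $n>5$, and let $D_{2n}$ be the dihedral subgroup of the symmetric group $S_n$ generated by $a=(1,2,\dots,n)$ and $b=(1,n)(2,n-1)(3,n-2)\cdots(\lfloor \frac n2\rfloor,\lceil\frac{n+2}{2}\rceil)$. Then the ring extension $\mathbb{C}D_{2n}\subseteq\mathbb{C}S_n$ has depth exactly $3$. -/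

import Mathlib

noncomputable section

/-! ### Depth of a matrix -/

section MatrixDepth

variable {r s : Type*} [Fintype r] [Fintype s] [DecidableEq r]

/-- The square `S = M Mᵗ`, i.e. the second power `M²` in the alternating convention
`M¹ = M`, `M² = M Mᵗ`, `M³ = M Mᵗ M`, `M⁴ = M Mᵗ M Mᵗ`, … -/
def matrixSquare (M : Matrix r s ℕ) : Matrix r r ℕ := M * M.transpose

/-- The even alternating power `M^(2k) = S^k`, an `r × r` matrix. -/
def evenPower (M : Matrix r s ℕ) (k : ℕ) : Matrix r r ℕ := matrixSquare M ^ k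

/-- The odd alternating power `M^(2k+1) = S^k M`, an `r × s` matrix. -/
def oddPower (M : Matrix r s ℕ) (k : ℕ) : Matrix r s ℕ := evenPower M k * M

/-- The depth `n` matrix inequality (for `n ≥ 1`): `M^(n+1) ≤ q M^(n-1)` entrywise, for some
positive integer `q`. For `n = 2m` both sides are odd powers, `S^m M ≤ q S^(m-1) M`; for
`n = 2m+1` they are even powers, `S^(m+1) ≤ q S^m`. -/
def DepthInequality (M : Matrix r s ℕ) (n : ℕ) : Prop :=
  ∃ q : ℕ, 0 < q ∧
    if Even n then ∀ i j, oddPower M (n / 2) i j ≤ q * oddPower M (n / 2 - 1) i j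
    else ∀ i j, evenPower M ((n + 1) / 2) i j ≤ q * evenPower M ((n - 1) / 2) i j

/-- `M` has depth `n` if `n` is the least integer `≥ 2` for which the depth `n` matrix
inequality holds. -/
def MatrixHasDepth (M : Matrix r s ℕ) (n : ℕ) : Prop :=
  IsLeast {k : ℕ | 2 ≤ k ∧ DepthInequality M k} n

end MatrixDepth

/-! ### Isomorphism classes of simple modules -/

section SimpleClass

variable (A : Type*) [Ring A]

/-- The simple left `A`-modules `A ⧸ I`, given by the maximal left ideals `I`, up to isomorphism.
Every simple left `A`-module is isomorphic to one of these. -/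
def simpleSetoid : Setoid {I : Submodule A A // IsCoatom I} where
  r I J := Nonempty ((A ⧸ I.1) ≃ₗ[A] (A ⧸ J.1))
  iseqv :=
    { refl := fun _ => ⟨LinearEquiv.refl _ _⟩
      symm := fun ⟨e⟩ => ⟨e.symm⟩
      trans := fun ⟨e⟩ ⟨f⟩ => ⟨e.trans f⟩ }

/-- The set of isomorphism classes of simple left `A`-modules. -/
def SimpleClass : Type _ := Quotient (simpleSetoid A)

variable {A}

/-- A simple left `A`-module in the given isomorphism class. -/
abbrev SimpleClass.Rep (c : SimpleClass A) : Type _ :=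
  A ⧸ (Quotient.out (s := simpleSetoid A) c).1

instance SimpleClass.isSimpleModule (c : SimpleClass A) : IsSimpleModule A c.Rep :=
  isSimpleModule_iff_isCoatom.mpr (Quotient.out (s := simpleSetoid A) c).2

/-- Every simple module is isomorphic to exactly one of the chosen representatives. -/
theorem SimpleClass.existsUnique_linearEquiv (V : Type*) [AddCommGroup V] [Module A V]
    [IsSimpleModule A V] : ∃! c : SimpleClass A, Nonempty (V ≃ₗ[A] c.Rep) := by
  obtain ⟨I, hI, ⟨e⟩⟩ := (isSimpleModule_iff_quot_maximal (R := A) (M := V)).mp inferInstance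
  have hI' : IsCoatom I := hI.out
  refine ⟨Quotient.mk (simpleSetoid A) ⟨I, hI'⟩, ?_, ?_⟩
  · obtain ⟨f⟩ := Quotient.mk_out (s := simpleSetoid A) ⟨I, hI'⟩
    exact ⟨e.trans f.symm⟩
  · rintro c ⟨f⟩
    rw [← Quotient.out_eq (s := simpleSetoid A) c]
    exact Quotient.sound (s := simpleSetoid A) ⟨f.symm.trans e⟩

instance SimpleClass.finite [IsSemisimpleRing A] : Finite (SimpleClass A) := by
  choose J e using fun c : SimpleClass A =>
    IsSemisimpleRing.exists_linearEquiv_ideal_of_isSimpleModule A c.Rep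
  have hJ : ∀ c, IsSimpleModule A (J c) := fun c => IsSimpleModule.congr (e c).some.symm
  let f : SimpleClass A → isotypicComponents A A :=
    fun c => ⟨isotypicComponent A A (J c), J c, hJ c, rfl⟩
  refine Finite.of_injective f fun c d h => ?_
  have h' : isotypicComponent A A (J c) = isotypicComponent A A (J d) := congrArg Subtype.val h
  have : Nonempty (J c ≃ₗ[A] J d) :=
    isIsotypicOfType_submodule_iff.mp (IsIsotypicOfType.isotypicComponent A A (J d)) (J c)
      (h' ▸ (J c).le_isotypicComponent)
  rw [← Quotient.out_eq (s := simpleSetoid A) c, ← Quotient.out_eq (s := simpleSetoid A) d]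
  exact Quotient.sound (s := simpleSetoid A)
    ⟨(e c).some.trans (this.some.trans (e d).some.symm)⟩

noncomputable instance SimpleClass.fintype [IsSemisimpleRing A] : Fintype (SimpleClass A) :=
  Fintype.ofFinite _

noncomputable instance SimpleClass.decidableEq : DecidableEq (SimpleClass A) :=
  Classical.decEq _

end SimpleClass

/-! ### The inclusion matrix of a pair of semisimple complex algebras -/

section InclusionMatrix

variable {A : Type*} [Ring A] [Algebra ℂ A]

/-- The inclusion matrix of `B ⊆ A`. Its rows are indexed by the simple `B`-modules `W`, its columns
by the simple `A`-modules `V`, and the entry at `(W, V)` is the multiplicity of `W` in the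
restriction of `V` to `B`, that is the dimension of `Hom_B(W, V)`. -/
def inclusionMatrix (B : Subalgebra ℂ A) : Matrix (SimpleClass B) (SimpleClass A) ℕ :=
  Matrix.of fun W V => Module.finrank ℂ (W.Rep →ₗ[B] V.Rep)

/-- The depth of an inclusion `B ⊆ A` of finite-dimensional semisimple complex algebras. -/
def InclusionHasDepth [FiniteDimensional ℂ A] [IsSemisimpleRing A]
    (B : Subalgebra ℂ A) [IsSemisimpleRing B] (n : ℕ) : Prop :=
  MatrixHasDepth (inclusionMatrix B) n

end InclusionMatrix

/-! ### Subgroups -/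

section SubgroupDepth

variable {G : Type*} [Group G]

/-- The group algebra `ℂH`, as a subalgebra of `ℂG`. -/
def groupSubalgebra (H : Subgroup G) : Subalgebra ℂ (MonoidAlgebra ℂ G) :=
  (MonoidAlgebra.mapDomainAlgHom ℂ ℂ H.subtype).range

/-- `ℂH` is isomorphic to its image in `ℂG`. -/
def groupSubalgebraEquiv (H : Subgroup G) : MonoidAlgebra ℂ H ≃ₐ[ℂ] groupSubalgebra H :=
  AlgEquiv.ofInjective (MonoidAlgebra.mapDomainAlgHom ℂ ℂ H.subtype)
    (MonoidAlgebra.mapDomain_injective H.subtype_injective)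

instance groupSubalgebra.isSemisimpleRing [Finite G] (H : Subgroup G) :
    IsSemisimpleRing (groupSubalgebra H) :=
  (groupSubalgebraEquiv H).toRingEquiv.isSemisimpleRing

/-- The subgroup `H` of the finite group `G` has depth `n`: the inclusion `ℂH ⊆ ℂG` has. -/
def SubgroupHasDepth [Finite G] (H : Subgroup G) (n : ℕ) : Prop :=
  InclusionHasDepth (groupSubalgebra H) n

end SubgroupDepth

/-- The dihedral subgroup `D_{2n}` of the symmetric group on `n` points, generated by the `n`-cycle
`a = (1 2 … n)` and the reflection `b = (1 n)(2 n-1)(3 n-2)⋯`, the order reversal. The points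
`1, …, n` are the elements `0, …, n-1` of `Fin n`. -/
def dihedralSubgroup (n : ℕ) : Subgroup (Equiv.Perm (Fin n)) :=
  Subgroup.closure {finRotate n, Fin.revPerm}

end

/-! Depth at most 3 follows once every entry of `S` is positive, i.e. any two simple `ℂH`-modules
occur together in some simple `ℂG`-module. This holds when `H ∩ x⁻¹Hx = 1` for some `x`: then `exe'
≠ 0` for nonzero `e, e' ∈ ℂH` (`mul_single_mul_ne_zero`), and a simple module on which `exe'` acts
nontrivially contains both constituents. Depth 2 fails because the column of `M` at the trivial
module has a zero entry when `H ≠ 1`, while `SM` is positive there. For the dihedral group, a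
3-cycle of consecutive points serves as `x` (`eq_zero_of_swap_conj_affine`). -/

section Matrix

variable {r s : Type*} [Fintype r] [Fintype s] [DecidableEq r]

theorem depthInequality_three_of_matrixSquare_pos (M : Matrix r s ℕ)
    (h : ∀ i j, 0 < matrixSquare M i j) : DepthInequality M 3 := by
  -- Entries of `S` are at least 1, so any positive bound for the entries of `S²` serves as `q`.
  refine ⟨1 + ∑ i, ∑ j, evenPower M 2 i j, by omega, ?_⟩
  rw [if_neg (by decide)]
  intro i j
  have h1 : evenPower M 2 i j ≤ ∑ i, ∑ j, evenPower M 2 i j :=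
    (Finset.single_le_sum (f := fun j => evenPower M 2 i j) (fun _ _ => Nat.zero_le _)
      (Finset.mem_univ j)).trans
    (Finset.single_le_sum (f := fun i => ∑ j, evenPower M 2 i j) (fun _ _ => Nat.zero_le _)
      (Finset.mem_univ i))
  have h2 : 0 < evenPower M ((3 - 1) / 2) i j := by simpa [evenPower] using h i j
  calc evenPower M 2 i j ≤ 1 + ∑ i, ∑ j, evenPower M 2 i j := by omega
    _ ≤ _ := Nat.le_mul_of_pos_right _ h2

/-- The entry of `SM` at `(i, j)` is at least `S i k * M k j > 0`, and no multiple of `M i j = 0`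
bounds it. -/
theorem not_depthInequality_two (M : Matrix r s ℕ) (h : ∀ i j, 0 < matrixSquare M i j)
    {i : r} {k : r} {j : s} (hi : M i j = 0) (hk : 0 < M k j) : ¬ DepthInequality M 2 := by
  rintro ⟨q, -, hq⟩
  rw [if_pos (by decide)] at hq
  have h1 : ∑ l, matrixSquare M i l * M l j ≤ q * M i j := by
    simpa only [oddPower, evenPower, Nat.div_self, Nat.two_pos, Nat.sub_self, pow_zero, pow_one,
      Matrix.one_mul, Matrix.mul_apply (M := matrixSquare M)] using hq i j
  rw [hi, mul_zero, nonpos_iff_eq_zero, Finset.sum_eq_zero_iff] at h1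
  exact (Nat.mul_pos (h i k) hk).ne' (h1 k (Finset.mem_univ k))

theorem matrixHasDepth_three (M : Matrix r s ℕ) (h : ∀ i j, 0 < matrixSquare M i j)
    {i : r} {k : r} {j : s} (hi : M i j = 0) (hk : 0 < M k j) : MatrixHasDepth M 3 := by
  refine ⟨⟨by omega, depthInequality_three_of_matrixSquare_pos M h⟩, fun n hn => ?_⟩
  by_contra hlt
  obtain rfl : n = 2 := by have := hn.1; omega
  exact not_depthInequality_two M h hi hk hn.2

end Matrix

/-! ### Semisimple rings -/

section Semisimple

variable {A : Type*} [Ring A]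

theorem exists_isCoatom_notMem [IsSemisimpleRing A] {a : A} (ha : a ≠ 0) :
    ∃ I : Submodule A A, IsCoatom I ∧ a ∉ I := by
  by_contra! h
  refine ha ?_
  have : a ∈ Ring.jacobson A := Submodule.mem_sInf.mpr h
  rwa [IsSemisimpleRing.jacobson_eq_bot, Submodule.mem_bot] at this

theorem exists_simpleClass_smul_ne_zero [IsSemisimpleRing A] {a : A} (ha : a ≠ 0) :
    ∃ c : SimpleClass A, ∃ v : c.Rep, a • v ≠ 0 := by
  obtain ⟨I, hI, haI⟩ := exists_isCoatom_notMem ha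
  have : IsSimpleModule A (A ⧸ I) := isSimpleModule_iff_isCoatom.mpr hI
  obtain ⟨c, ⟨e⟩, -⟩ := SimpleClass.existsUnique_linearEquiv (A := A) (A ⧸ I)
  refine ⟨c, e (Submodule.Quotient.mk 1), fun h => haI ?_⟩
  rw [← map_smul, LinearEquiv.map_eq_zero_iff, ← Submodule.Quotient.mk_smul,
    Submodule.Quotient.mk_eq_zero] at h
  simpa using h

/-- Every proper left ideal of a semisimple ring has a nonzero right annihilator. -/
theorem exists_ne_zero_forall_mul_eq_zero [IsSemisimpleRing A] {I : Submodule A A} (hI : I ≠ ⊤) :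
    ∃ e : A, e ≠ 0 ∧ ∀ b ∈ I, b * e = 0 := by
  obtain ⟨J, hJ⟩ := exists_isCompl I
  -- Split `1 = i + e` along `A = I ⊕ J`; for `b ∈ I`, `be = b - bi` lies in `I ∩ J = 0`.
  have h1 : (1 : A) ∈ I ⊔ J := hJ.sup_eq_top ▸ Submodule.mem_top
  obtain ⟨i, hi, e, he, hie⟩ := Submodule.mem_sup.mp h1
  refine ⟨e, ?_, fun b hb => ?_⟩
  · rintro rfl
    rw [add_zero] at hie
    exact hI ((Ideal.eq_top_iff_one I).mpr (hie ▸ hi))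
  · have h2 : b * e = b - b * i := by
      rw [eq_sub_iff_add_eq, ← mul_add, add_comm e i, hie, mul_one]
    have h3 : b * e ∈ I ⊓ J :=
      ⟨h2 ▸ I.sub_mem hb (I.smul_mem b hi), J.smul_mem b he⟩
    rwa [hJ.inf_eq_bot, Submodule.mem_bot] at h3

end Semisimple

/-! ### Constituents of restricted modules -/

section Inclusion

variable {A : Type*} [Ring A] [Algebra ℂ A]

theorem inclusionMatrix_eq_zero (B : Subalgebra ℂ A) {W : SimpleClass B} {V : SimpleClass A}
    {b : B} {w : W.Rep} (hw : b • w ≠ 0) (hV : ∀ v : V.Rep, (b : A) • v = 0) :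
    inclusionMatrix B W V = 0 := by
  have : Subsingleton (W.Rep →ₗ[B] V.Rep) := by
    refine subsingleton_of_forall_eq 0 fun f => ?_
    refine (LinearMap.injective_or_eq_zero f).resolve_left fun hf => hw (hf ?_)
    rw [map_smul, map_zero]
    exact hV (f w)
  exact Module.finrank_zero_of_subsingleton

variable [FiniteDimensional ℂ A]

/-- `W` is cyclic, so evaluation at the class of 1 is injective. Needed because `finrank` is 0 on
infinite-dimensional spaces. -/
theorem finiteDimensional_hom (B : Subalgebra ℂ A) (W : SimpleClass B) (V : SimpleClass A) :
    FiniteDimensional ℂ (W.Rep →ₗ[B] V.Rep) := by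
  have : FiniteDimensional ℂ V.Rep := inferInstance
  let f : (W.Rep →ₗ[B] V.Rep) →ₗ[ℂ] V.Rep :=
    { toFun := fun g => g (Submodule.Quotient.mk 1)
      map_add' := fun _ _ => rfl
      map_smul' := fun _ _ => rfl }
  refine FiniteDimensional.of_injective f fun g₁ g₂ h => ?_
  ext
  exact h

theorem inclusionMatrix_pos (B : Subalgebra ℂ A) {W : SimpleClass B} {V : SimpleClass A}
    (f : W.Rep →ₗ[B] V.Rep) (hf : f ≠ 0) : 0 < inclusionMatrix B W V := by
  have := finiteDimensional_hom B W V
  have : Nontrivial (W.Rep →ₗ[B] V.Rep) := ⟨f, 0, hf⟩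
  exact Module.finrank_pos

/-- With `W = B ⧸ I` and `Ie = 0`, the map `b ↦ bev` factors through `W` and is nonzero at 1. -/
theorem inclusionMatrix_pos_of_smul (B : Subalgebra ℂ A) {W : SimpleClass B} {V : SimpleClass A}
    {e : B} (he : ∀ b ∈ (Quotient.out (s := simpleSetoid B) W).1, b * e = 0) {v : V.Rep}
    (hv : (e : A) • v ≠ 0) : 0 < inclusionMatrix B W V := by
  let f : W.Rep →ₗ[B] V.Rep :=
    Submodule.liftQ _ (LinearMap.toSpanSingleton B V.Rep (e • v)) fun b hb => by
      rw [LinearMap.mem_ker, LinearMap.toSpanSingleton_apply, smul_smul, he b hb, zero_smul]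
  refine inclusionMatrix_pos B f fun h => hv ?_
  have h1 : f (Submodule.Quotient.mk 1) = e • v := by
    simp [f]
  rw [h] at h1
  exact h1.symm

theorem matrixSquare_inclusionMatrix_pos [IsSemisimpleRing A] (B : Subalgebra ℂ A)
    [IsSemisimpleRing B]
    (hB : ∀ e e' : B, e ≠ 0 → e' ≠ 0 → ∃ a : A, (e : A) * a * e' ≠ 0) (W W' : SimpleClass B) :
    0 < matrixSquare (inclusionMatrix B) W W' := by
  obtain ⟨e, he0, he⟩ :=
    exists_ne_zero_forall_mul_eq_zero (Quotient.out (s := simpleSetoid B) W).2.1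
  obtain ⟨e', he0', he'⟩ :=
    exists_ne_zero_forall_mul_eq_zero (Quotient.out (s := simpleSetoid B) W').2.1
  obtain ⟨a, ha⟩ := hB e e' he0 he0'
  obtain ⟨V, v, hv⟩ := exists_simpleClass_smul_ne_zero ha
  -- `e(ae'v) ≠ 0` puts `W` in `V`, and it forces `e'v ≠ 0`, which puts `W'` there.
  rw [mul_smul, mul_smul] at hv
  have h1 : 0 < inclusionMatrix B W V := inclusionMatrix_pos_of_smul B he hv
  have h2 : 0 < inclusionMatrix B W' V :=
    inclusionMatrix_pos_of_smul B he' (v := v) fun h => hv (by rw [h, smul_zero, smul_zero])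
  rw [matrixSquare, Matrix.mul_apply]
  exact Finset.sum_pos' (fun _ _ => Nat.zero_le _)
    ⟨V, Finset.mem_univ V, Nat.mul_pos h1 h2⟩

theorem exists_inclusionMatrix_pos (B : Subalgebra ℂ A) [IsSemisimpleRing B] (V : SimpleClass A) :
    ∃ W, 0 < inclusionMatrix B W V := by
  have : Nontrivial V.Rep := IsSimpleModule.nontrivial A V.Rep
  obtain ⟨m, hm⟩ := IsAtomic.exists_atom (Submodule B V.Rep)
  have : IsSimpleModule B m := isSimpleModule_iff_isAtom.mpr hm
  obtain ⟨W, ⟨e⟩, -⟩ := SimpleClass.existsUnique_linearEquiv (A := B) m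
  refine ⟨W, inclusionMatrix_pos B (m.subtype ∘ₗ e.symm.toLinearMap) fun h => ?_⟩
  have : Nontrivial m := IsSimpleModule.nontrivial B m
  obtain ⟨x, hx⟩ := exists_ne (0 : m)
  refine hx (Subtype.ext ?_)
  simpa using LinearMap.congr_fun h (e x)

/-- An inclusion `B ⊆ A` has depth three when `e A e' ≠ 0` for all nonzero `e`, `e'` in `B`, and
some nonzero element of `B` kills a simple `A`-module. -/
theorem inclusionHasDepth_three [IsSemisimpleRing A] (B : Subalgebra ℂ A) [IsSemisimpleRing B]
    (hB : ∀ e e' : B, e ≠ 0 → e' ≠ 0 → ∃ a : A, (e : A) * a * e' ≠ 0) {b : B} (hb : b ≠ 0)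
    {V : SimpleClass A} (hV : ∀ v : V.Rep, (b : A) • v = 0) : InclusionHasDepth B 3 := by
  obtain ⟨W, w, hw⟩ := exists_simpleClass_smul_ne_zero hb
  obtain ⟨W', hW'⟩ := exists_inclusionMatrix_pos B V
  exact matrixHasDepth_three _ (matrixSquare_inclusionMatrix_pos B hB)
    (inclusionMatrix_eq_zero B hw hV) hW'

end Inclusion

/-! ### Group algebras -/

section GroupAlgebra

variable {G : Type*} [Group G]

theorem support_subset_of_mem_groupSubalgebra {H : Subgroup G} {b : MonoidAlgebra ℂ G}
    (hb : b ∈ groupSubalgebra H) {g : G} (hg : g ∈ b.coeff.support) : g ∈ H := by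
  classical
  obtain ⟨a, rfl⟩ := hb
  have := Finsupp.mapDomain_support (f := (H.subtype : H → G)) (s := a.coeff) hg
  obtain ⟨h, -, rfl⟩ := Finset.mem_image.mp this
  exact h.2

theorem single_mem_groupSubalgebra {H : Subgroup G} {g : G} (hg : g ∈ H) :
    MonoidAlgebra.single g 1 ∈ groupSubalgebra H :=
  ⟨MonoidAlgebra.single ⟨g, hg⟩ 1, MonoidAlgebra.mapDomain_single⟩

/-- If `x⁻¹Hx` meets `H` trivially, the map `ℂH ⊗ ℂH → ℂG`, `e ⊗ e' ↦ exe'`, kills no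
nonzero pure tensor. -/
theorem mul_single_mul_ne_zero {H : Subgroup G} {x : G}
    (hx : ∀ k ∈ H, x * k * x⁻¹ ∈ H → k = 1) {e e' : MonoidAlgebra ℂ G}
    (he : e ∈ groupSubalgebra H) (he' : e' ∈ groupSubalgebra H) (he0 : e ≠ 0) (he0' : e' ≠ 0) :
    e * MonoidAlgebra.single x 1 * e' ≠ 0 := by
  have key : ∀ b : MonoidAlgebra ℂ G, b ≠ 0 → ∃ g, g ∈ b.coeff.support := fun b hb =>
    Finsupp.support_nonempty_iff.mpr fun h => hb (MonoidAlgebra.coeff_eq_zero.mp h)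
  obtain ⟨g, hg⟩ := key e he0
  obtain ⟨g', hg'⟩ := key e' he0'
  -- If `axb' = gxg'`, then `x(g'b'⁻¹)x⁻¹ = g⁻¹a ∈ H`, so `b' = g'` and `a = g`. Hence the
  -- coefficient of `exe'` at `gxg'` is the single product `e(g)e'(g') ≠ 0`.
  have hU : UniqueMul e.coeff.support (MonoidAlgebra.single x 1 * e').coeff.support g (x * g') := by
    intro a b ha hb hab
    rw [Finsupp.mem_support_iff, MonoidAlgebra.coeff_single_mul_apply, one_mul,
      ← Finsupp.mem_support_iff] at hb
    have ha := support_subset_of_mem_groupSubalgebra he ha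
    have hb := support_subset_of_mem_groupSubalgebra he' hb
    have hg := support_subset_of_mem_groupSubalgebra he hg
    have hg' := support_subset_of_mem_groupSubalgebra he' hg'
    have h1 : x * (g' * (x⁻¹ * b)⁻¹) * x⁻¹ = g⁻¹ * a := by
      rw [eq_inv_mul_iff_mul_eq, ← mul_inv_eq_iff_eq_mul.mpr hab.symm]
      group
    have h2 := hx _ (H.mul_mem hg' (H.inv_mem hb)) (h1 ▸ H.mul_mem (H.inv_mem hg) ha)
    have h3 : b = x * g' := by
      rw [mul_inv_eq_one.mp h2]; group
    exact ⟨mul_right_cancel (h3 ▸ hab), h3⟩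
  intro h0
  have h1 := MonoidAlgebra.coeff_mul_mul_of_uniqueMul hU
  rw [← mul_assoc, h0, MonoidAlgebra.coeff_single_mul_apply, one_mul, inv_mul_cancel_left] at h1
  exact mul_ne_zero (Finsupp.mem_support_iff.mp hg) (Finsupp.mem_support_iff.mp hg') h1.symm

/-- The trivial representation is a simple module of the group algebra. -/
theorem exists_simpleClass_trivial :
    ∃ V : SimpleClass (MonoidAlgebra ℂ G), ∀ g : G, ∀ v : V.Rep,
      (MonoidAlgebra.single g (1 : ℂ) - 1 : MonoidAlgebra ℂ G) • v = 0 := by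
  let ε : MonoidAlgebra ℂ G →ₐ[ℂ] ℂ := MonoidAlgebra.lift ℂ ℂ G 1
  have hε : ∀ g, ε (MonoidAlgebra.single g 1) = 1 := fun g => by simp [ε]
  have hI : IsCoatom (RingHom.ker ε : Submodule (MonoidAlgebra ℂ G) (MonoidAlgebra ℂ G)) := by
    refine ⟨fun h => ?_, fun J hJ => ?_⟩
    · have h1 := (Ideal.eq_top_iff_one _).mp h
      rw [RingHom.mem_ker, map_one] at h1
      exact one_ne_zero h1
    · obtain ⟨j, hj, hj'⟩ := SetLike.exists_of_lt hJ
      rw [RingHom.mem_ker] at hj'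
      refine (Ideal.eq_top_iff_one J).mpr ?_
      have h1 : algebraMap ℂ (MonoidAlgebra ℂ G) (ε j)⁻¹ * j ∈ J := J.smul_mem _ hj
      have h2 : 1 - algebraMap ℂ (MonoidAlgebra ℂ G) (ε j)⁻¹ * j ∈ J := by
        refine hJ.le ?_
        rw [RingHom.mem_ker, map_sub, map_mul, map_one, AlgHom.commutes]
        simp [hj']
      simpa using J.add_mem h2 h1
  have := isSimpleModule_iff_isCoatom.mpr hI
  obtain ⟨V, ⟨e⟩, -⟩ := SimpleClass.existsUnique_linearEquiv (A := MonoidAlgebra ℂ G)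
    (MonoidAlgebra ℂ G ⧸ (RingHom.ker ε : Submodule (MonoidAlgebra ℂ G) (MonoidAlgebra ℂ G)))
  refine ⟨V, fun g v => ?_⟩
  obtain ⟨u, rfl⟩ := e.surjective v
  obtain ⟨a, rfl⟩ := Submodule.Quotient.mk_surjective _ u
  rw [← map_smul, ← Submodule.Quotient.mk_smul, LinearEquiv.map_eq_zero_iff,
    Submodule.Quotient.mk_eq_zero, RingHom.mem_ker, smul_eq_mul, map_mul, map_sub, hε, map_one,
    sub_self, zero_mul]

theorem subgroupHasDepth_three [Finite G] {H : Subgroup G} (hH : H ≠ ⊥) {x : G}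
    (hx : ∀ k ∈ H, x * k * x⁻¹ ∈ H → k = 1) : SubgroupHasDepth H 3 := by
  obtain ⟨⟨h, hh⟩, h1⟩ := Subgroup.ne_bot_iff_exists_ne_one.mp hH
  obtain ⟨V, hV⟩ := exists_simpleClass_trivial (G := G)
  refine inclusionHasDepth_three (groupSubalgebra H)
    (fun e e' he he' => ⟨_, mul_single_mul_ne_zero hx e.2 e'.2 (by simpa using he)
      (by simpa using he')⟩)
    (b := ⟨MonoidAlgebra.single h 1 - 1,
      sub_mem (single_mem_groupSubalgebra hh) (one_mem _)⟩) (fun h0 => h1 ?_) (hV h)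
  have h2 : (MonoidAlgebra.single h 1 : MonoidAlgebra ℂ G) = MonoidAlgebra.single 1 1 :=
    sub_eq_zero.mp (congrArg Subtype.val h0)
  exact Subtype.ext (MonoidAlgebra.of_injective (R := ℂ) h2)

end GroupAlgebra

/-! ### The dihedral group and a 3-cycle -/

section Affine

variable {R : Type*} [CommRing R]

/-- Since `h` and `k` preserve differences up to sign, `k` sends the pair 2, 3 to adjacent points
whose `x`-values differ by `±3`. Only the pair 2, 3 has this property, so `k` preserves it. -/
theorem eq_zero_of_swap_conj_affine (h2 : (2 : R) ≠ 0) (h3 : (3 : R) ≠ 0) (h4 : (4 : R) ≠ 0)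
    (h5 : (5 : R) ≠ 0) (x h k : R → R) (hx0 : x 0 = 1) (hx1 : x 1 = 2)
    (hx2 : x 2 = 0)
    (hx : ∀ i, i ≠ 0 → i ≠ 1 → i ≠ 2 → x i = i)
    (hh : ∃ c, (∀ i, h i = i + c) ∨ ∀ i, h i = c - i)
    (hk : ∃ c, (∀ i, k i = i + c) ∨ ∀ i, k i = c - i)
    (hc : ∀ i, h (x i) = x (k i)) : ∀ i, k i = i := by
  have h1 : (1 : R) ≠ 0 := fun e => h2 (by linear_combination 2 * e)
  have hx3 : x 3 = 3 := hx 3 h3 (fun e => h2 (by linear_combination e))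
    (fun e => h1 (by linear_combination e))
  have hx4 : x 4 = 4 := hx 4 h4 (fun e => h3 (by linear_combination e))
    (fun e => h2 (by linear_combination e))
  -- The step `x (a + 1) - x a` is 1, -2, 3, 2 at `a = 0, 1, 2, -1` and 1 elsewhere.
  have hD : ∀ a, a ≠ 2 → x (a + 1) - x a ≠ 3 ∧ x (a + 1) - x a ≠ -3 := by
    intro a ha
    by_cases a0 : a = 0
    · subst a0
      rw [zero_add, hx0, hx1]
      exact ⟨fun e => h2 (by linear_combination -e), fun e => h4 (by linear_combination e)⟩
    by_cases a1 : a = 1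
    · subst a1
      rw [one_add_one_eq_two, hx1, hx2]
      exact ⟨fun e => h5 (by linear_combination -e), fun e => h1 (by linear_combination e)⟩
    by_cases a2 : a = -1
    · subst a2
      rw [neg_add_cancel, hx0, hx (-1) (fun e => h1 (by linear_combination -e))
        (fun e => h2 (by linear_combination -e)) (fun e => h3 (by linear_combination -e))]
      exact ⟨fun e => h1 (by linear_combination -e), fun e => h5 (by linear_combination e)⟩
    · rw [hx a a0 a1 ha, hx (a + 1) (fun e => a2 (by linear_combination e))
        (fun e => a0 (by linear_combination e)) (fun e => a1 (by linear_combination e))]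
      exact ⟨fun e => h2 (by linear_combination -e), fun e => h4 (by linear_combination e)⟩
  have c1 := hc 1
  have c2 := hc 2
  have c3 := hc 3
  rw [hx1] at c1
  rw [hx2] at c2
  rw [hx3] at c3
  obtain ⟨d, hk | hk⟩ := hk
  · have hd : 2 + d = 2 := by
      by_contra hne
      have := hD _ hne
      rw [show 2 + d + 1 = 3 + d by ring, ← hk, ← hk, ← c2, ← c3] at this
      obtain ⟨c, hh | hh⟩ := hh <;> rw [hh, hh] at this
      · exact this.1 (by ring)
      · exact this.2 (by ring)
    intro i
    rw [hk]
    linear_combination hd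
  -- A reflection would swap 2 and 3, hence send 1 to 4. Then `h 2 = 4` and `h 0 = 3`, so `h` would
  -- turn a difference of 2 into 1, forcing `1 = 0` or `3 = 0`.
  · exfalso
    have hd : d - 3 = 2 := by
      by_contra hne
      have := hD _ hne
      rw [show d - 3 + 1 = d - 2 by ring, ← hk, ← hk, ← c2, ← c3] at this
      obtain ⟨c, hh | hh⟩ := hh <;> rw [hh, hh] at this
      · exact this.2 (by ring)
      · exact this.1 (by ring)
    have e1 : k 1 = 4 := by rw [hk]; linear_combination hd
    have e2 : k 2 = 3 := by rw [hk]; linear_combination hd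
    rw [e1, hx4] at c1
    rw [e2, hx3] at c2
    obtain ⟨c, hh | hh⟩ := hh <;> rw [hh] at c1 c2
    · exact h1 (by linear_combination c1 - c2)
    · exact h3 (by linear_combination c2 - c1)

end Affine

open Fin.CommRing in
theorem exists_eq_add_or_eq_sub_of_mem_dihedralSubgroup (n : ℕ) [NeZero n] {g : Equiv.Perm (Fin n)}
    (hg : g ∈ dihedralSubgroup n) : ∃ c, (∀ i, g i = i + c) ∨ ∀ i, g i = c - i := by
  induction hg using Subgroup.closure_induction with
  | mem g hg =>
    obtain rfl | rfl := hg
    · exact ⟨1, Or.inl fun i => finRotate_apply i⟩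
    -- With points numbered from 0, the reversal is `i ↦ n - 1 - i`, which is `-1 - i` modulo `n`.
    · refine ⟨-1, Or.inr fun i => ?_⟩
      rw [Fin.revPerm_apply]
      obtain ⟨m, rfl⟩ := Nat.exists_eq_succ_of_ne_zero (NeZero.ne n)
      rw [eq_sub_iff_add_eq, eq_neg_iff_add_eq_zero]
      have h : Fin.rev i + i = Fin.last m := by
        ext
        rw [Fin.val_add_eq_of_add_lt] <;> simp <;> omega
      rw [h, Fin.last_add_one]
  | one => exact ⟨0, Or.inl fun i => by simp⟩
  | mul g h _ _ hg hh =>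
    obtain ⟨c, hg | hg⟩ := hg <;> obtain ⟨d, hh | hh⟩ := hh
    · exact ⟨c + d, Or.inl fun i => by rw [Equiv.Perm.mul_apply, hg, hh]; ring⟩
    · exact ⟨c + d, Or.inr fun i => by rw [Equiv.Perm.mul_apply, hg, hh]; ring⟩
    · exact ⟨c - d, Or.inr fun i => by rw [Equiv.Perm.mul_apply, hg, hh]; ring⟩
    · exact ⟨c - d, Or.inl fun i => by rw [Equiv.Perm.mul_apply, hg, hh]; ring⟩
  | inv g _ hg =>
    obtain ⟨c, hg | hg⟩ := hg
    · exact ⟨-c, Or.inl fun i => by rw [Equiv.Perm.inv_eq_iff_eq, hg]; ring⟩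
    · exact ⟨c, Or.inr fun i => by rw [Equiv.Perm.inv_eq_iff_eq, hg]; ring⟩

open Fin.CommRing in
theorem exists_forall_conj_mem_dihedralSubgroup (n : ℕ) (hn : 5 < n) :
    ∃ x : Equiv.Perm (Fin n), ∀ k ∈ dihedralSubgroup n,
      x * k * x⁻¹ ∈ dihedralSubgroup n → k = 1 := by
  have : NeZero n := ⟨by omega⟩
  have hne : ∀ m : ℕ, 0 < m → m < 6 → (m : Fin n) ≠ 0 := by
    intro m h0 h6 h
    rw [Fin.natCast_eq_zero] at h
    exact absurd (Nat.le_of_dvd h0 h) (by omega)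
  have h1 : (1 : Fin n) ≠ 0 := by simpa using hne 1 (by omega) (by omega)
  have h2 : (2 : Fin n) ≠ 0 := by simpa using hne 2 (by omega) (by omega)
  have h3 : (3 : Fin n) ≠ 0 := by simpa using hne 3 (by omega) (by omega)
  have h4 : (4 : Fin n) ≠ 0 := by simpa using hne 4 (by omega) (by omega)
  have h5 : (5 : Fin n) ≠ 0 := by simpa using hne 5 (by omega) (by omega)
  have h12 : (1 : Fin n) ≠ 2 := fun e => h1 (by linear_combination -e)
  -- This product is the 3-cycle `0 ↦ 1 ↦ 2 ↦ 0`.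
  refine ⟨Equiv.swap 0 1 * Equiv.swap 1 2, fun k hk hxk => ?_⟩
  ext1 i
  refine eq_zero_of_swap_conj_affine h2 h3 h4 h5
    ((Equiv.swap 0 1 * Equiv.swap 1 2 : Equiv.Perm (Fin n))) _ k ?_ ?_ ?_ ?_
    (exists_eq_add_or_eq_sub_of_mem_dihedralSubgroup n hxk)
    (exists_eq_add_or_eq_sub_of_mem_dihedralSubgroup n hk) ?_ i
  · rw [Equiv.Perm.mul_apply, Equiv.swap_apply_of_ne_of_ne h1.symm h2.symm, Equiv.swap_apply_left]
  · rw [Equiv.Perm.mul_apply, Equiv.swap_apply_left, Equiv.swap_apply_of_ne_of_ne h2 h12.symm]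
  · rw [Equiv.Perm.mul_apply, Equiv.swap_apply_right, Equiv.swap_apply_right]
  · intro i i0 i1 i2
    rw [Equiv.Perm.mul_apply, Equiv.swap_apply_of_ne_of_ne i1 i2,
      Equiv.swap_apply_of_ne_of_ne i0 i1]
  · intro i
    simp only [← Equiv.Perm.mul_apply, inv_mul_cancel_right]

theorem dihedralSubgroup_ne_bot {n : ℕ} (hn : 1 < n) : dihedralSubgroup n ≠ ⊥ := by
  have : NeZero n := ⟨by omega⟩
  refine Subgroup.ne_bot_iff_exists_ne_one.mpr
    ⟨⟨finRotate n, Subgroup.subset_closure (Set.mem_insert _ _)⟩, fun h => ?_⟩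
  have h1 : finRotate n 0 = 0 := congrArg (fun g : dihedralSubgroup n => g.1 0) h
  rw [finRotate_apply, zero_add, Fin.one_eq_zero_iff] at h1
  omega

theorem mainTheorem8 (n : ℕ) (hn : 5 < n) : SubgroupHasDepth (dihedralSubgroup n) 3 := by
  obtain ⟨x, hx⟩ := exists_forall_conj_mem_dihedralSubgroup n hn
  exact subgroupHasDepth_three (dihedralSubgroup_ne_bot (by omega)) hx
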